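/- Let $\mathcal{M}=(S,s_1,\mathcal{A},\mathcal{P})$ be a finite Markov decision process: $S$ and $\mathcal{A}$ are finite sets, $s_1\in S$ is the initial state, each state $s$ has a nonempty set $\mathcal{A}(s)\subseteq\mathcal{A}$ of available actions, and $\sum_{s'\in S}\mathcal{P}_{s,a,s'}=1$ for all $s\in S$ and $a\in\mathcal{A}(s)$, with $\mathcal{P}_{s,a,s'}\ge 0$. Let $\Pi(\mathcal{M})$ be the set of all (randomized, time-dependent) Markovian policies $\pi=(d_1,d_2,\ldots)$, where $d_t(s,\cdot)$ is a probability distribution on $\mathcal{A}(s)$ for all $t\ge 1$ and $s\in S$. Let $B\subseteq S$ be a set of absorbing states ($\mathcal{P}_{s,a,s}=1$ for all $s\in B$ and $a\in\mathcal{A}(s)$), let $c:S\times\mathcal{A}\to\mathbb{R}_{\ge 0}$, let $\beta\in(0,1)$, and let $$J(\pi)=\mathbb{E}^{\pi}\Big[\sum_{t=1}^{\infty}\beta^{t-1}c(s_t,a_t)\Big]$$ be the expected total discounted cost of the process that starts in $s_1$ and follows $\pi$. Let $\Xi(\mathcal{M},B)\subseteq\Pi(\mathcal{M})$ be the set of policies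 that maximize, over $\Pi(\mathcal{M})$, the probability of reaching $B$ from $s_1$. For $s\in S$, let $x_s$ be the maximum over $\Pi(\mathcal{M})$ of the probability of reaching $B$ from $s$, let $S_0$ be the set of states from which $B$ is reached with probability zero under every policy, and let $S_r=S\setminus(B\cup S_0)$. Let the cleaned-up MDP $\mathcal{M}'$ be obtained from $\mathcal{M}$ by keeping, in each state $s\in S_r$, only the actions in $$\mathcal{A}_{\max}(s)=\Big\{a\in\mathcal{A}(s)\ :\ x_s=\sum_{s'\in S}\mathcal{P}_{s,a,s'}\,x_{s'}\Big\}.$$ Then $\Xi(\mathcal{M},B)$ is nonempty, the minimum of $J$ over $\Pi(\mathcal{M}')$ is attained, and $$\inf_{\pi\in\Xi(\mathcal{M},B)}J(\pi)=\min_{\pi\in\Pi(\mathcal{M}')}J(\pi).$$ -/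

import Mathlib

open scoped NNReal ENNReal
open MeasureTheory ProbabilityTheory

/-- A finite Markov decision process with states `S`, actions `A`, initial state `init`, available
actions `avail s ⊆ A` and transition probabilities `trans s a s'`, which sum to one over `s'` for
every available action. -/
structure MDP (S A : Type*) [Fintype S] where
  init : S
  avail : S → Finset A
  trans : S → A → S → ℝ≥0
  sum_trans : ∀ s, ∀ a ∈ avail s, ∑ s', trans s a s' = 1

namespace MDP

variable {S A : Type*} [Fintype S]

/-- Every available action of `s` leads back to `s` with probability one. -/
def IsAbsorbing (M : MDP S A) (s : S) : Prop := ∀ a ∈ M.avail s, M.trans s a s = 1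

/-- A (randomized, time-dependent, Markovian) policy: `prob t s a` is the probability of taking
action `a` in state `s` at time `t`. Times are numbered from `0`. -/
structure Policy (M : MDP S A) where
  prob : ℕ → S → A → ℝ≥0
  sum_prob : ∀ t s, ∑ a ∈ M.avail s, prob t s a = 1
  prob_eq_zero : ∀ t s a, a ∉ M.avail s → prob t s a = 0

/-- The decision rule of a policy at time `t` in state `s`, as a probability mass function. -/
noncomputable def Policy.rule {M : MDP S A} (π : M.Policy) (t : ℕ) (s : S) : PMF A :=
  PMF.ofFinset (fun a => (π.prob t s a : ℝ≥0∞)) (M.avail s)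
    (by exact_mod_cast π.sum_prob t s)
    (fun a ha => by simp [π.prob_eq_zero t s a ha])

open Classical in
/-- The distribution of the successor state after taking `a` in `s`. Unavailable actions are never
taken under any policy, so the value for them is immaterial. -/
noncomputable def next (M : MDP S A) (s : S) (a : A) : PMF S :=
  if h : a ∈ M.avail s then
    PMF.ofFintype (fun s' => (M.trans s a s' : ℝ≥0∞)) (by exact_mod_cast M.sum_trans s a h)
  else PMF.pure s

/-- The distribution of the state-action pair at time `t` given that the state is `s`. -/
noncomputable def Policy.pair {M : MDP S A} (π : M.Policy) (t : ℕ) (s : S) : PMF (S × A) :=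
  (π.rule t s).map fun a => (s, a)

variable [Fintype A] [MeasurableSpace S] [DiscreteMeasurableSpace S]
  [MeasurableSpace A] [DiscreteMeasurableSpace A]

/-- The conditional law of the state-action pair at time `t + 1` given the history up to time `t`:
the successor state is drawn from the transition probabilities at the current pair, and then an
action is drawn from the decision rule of time `t + 1`. -/
noncomputable def Policy.kernel {M : MDP S A} (π : M.Policy) (t : ℕ) :
    Kernel ((_i : Finset.Iic t) → S × A) (S × A) :=
  Kernel.ofFunOfCountable fun h =>
    ((M.next (h ⟨t, by simp⟩).1 (h ⟨t, by simp⟩).2).bind (π.pair (t + 1))).toMeasure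

instance Policy.isMarkovKernel_kernel {M : MDP S A} (π : M.Policy) (t : ℕ) :
    IsMarkovKernel (π.kernel t) :=
  ⟨fun h => by
    change IsProbabilityMeasure (PMF.toMeasure _)
    infer_instance⟩

/-- The law of the infinite sequence of state-action pairs generated under the policy `π` when the
process starts in the state `s`. -/
noncomputable def Policy.law {M : MDP S A} (π : M.Policy) (s : S) : Measure (ℕ → S × A) :=
  Kernel.trajMeasure (X := fun _ => S × A) (π.pair 0 s).toMeasure π.kernel

/-- The probability of reaching the set `B` from the state `s` under the policy `π`. -/
noncomputable def Policy.reachProb {M : MDP S A} (π : M.Policy) (B : Set S) (s : S) : ℝ :=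
  (π.law s).real {ω | ∃ t, (ω t).1 ∈ B}

/-- The expected total discounted cost of the policy `π` from the initial state. -/
noncomputable def Policy.cost {M : MDP S A} (π : M.Policy) (c : S → A → ℝ≥0) (β : ℝ) : ℝ :=
  ∫ ω, ∑' t : ℕ, β ^ t * (c (ω t).1 (ω t).2 : ℝ) ∂(π.law M.init)

/-- The policies that maximize the probability of reaching `B` from the initial state. -/
def maxReachPolicies (M : MDP S A) (B : Set S) : Set M.Policy :=
  {π | ∀ π' : M.Policy, π'.reachProb B M.init ≤ π.reachProb B M.init}

/-- The maximum probability of reaching `B` from the state `s`. -/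
noncomputable def maxReach (M : MDP S A) (B : Set S) (s : S) : ℝ :=
  ⨆ π : M.Policy, π.reachProb B s

/-- The states from which `B` is reached with probability zero under every policy. -/
def zeroStates (M : MDP S A) (B : Set S) : Set S :=
  {s | ∀ π : M.Policy, π.reachProb B s = 0}

/-- The remaining states, neither in `B` nor in `zeroStates`. -/
def remStates (M : MDP S A) (B : Set S) : Set S := (B ∪ M.zeroStates B)ᶜ

open Classical in
/-- The available actions of `s` that preserve the maximum reachability probability. -/
noncomputable def maxActions (M : MDP S A) (B : Set S) (s : S) : Finset A :=
  {a ∈ M.avail s | M.maxReach B s = ∑ s', (M.trans s a s' : ℝ) * M.maxReach B s'}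

open Classical in
/-- The cleaned-up MDP: in each state of `remStates` only the actions of `maxActions` are kept;
nothing else changes. -/
noncomputable def cleanUp (M : MDP S A) (B : Set S) : MDP S A where
  init := M.init
  avail s := if s ∈ M.remStates B then M.maxActions B s else M.avail s
  trans := M.trans
  sum_trans s a ha := by
    refine M.sum_trans s a ?_
    split_ifs at ha
    · exact (Finset.mem_filter.mp ha).1
    · exact ha

end MDP

/-! A policy acts on functions of the state through the operators `iter n`. Since `B` is absorbing,
the probability of reaching it is the limit of `iter n (ind B)` (`tendsto_iter_ind`), and the cost
is a discounted series of iterates (`hasSum_cost`). After these two facts the trajectory measure is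
hardly needed.

Write x for `maxReach`. Policy improvement among the finitely many stationary deterministic policies
yields one policy σ that attains x from every state, and x is excessive: no action increases it on
average (`exists_reachProb_eq_maxReach`). For a policy π the mean of x at time n is therefore
nonincreasing in n, and it stays above the reachability probability of π. If π is optimal from the
initial state, this mean is constant, so at every state visited with positive probability π uses
only actions that preserve x (`iter_maxReach_sub_step`). Changing π elsewhere gives a policy of the
cleaned-up process with the same cost (`cost_toCleanUp`), hence the lower bound.

Conversely, a policy ρ of the cleaned-up process preserves the mean of x but may postpone reaching
`B` forever, so it need not be optimal. Following ρ up to time T and σ afterwards is optimal for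
every T (`reachProb_switch`), and by discounting its cost tends to that of ρ
(`tendsto_cost_switch`). This is why an infimum stands on the constrained side. The minimum on the
other side comes from the contraction argument for the discounted optimality equation
(`exists_cost_le`). -/

open Filter Topology

/-! ### One-step expectations and the operators of a policy -/

namespace MDP

variable {S A : Type*} [Fintype S]

/-- The expected value of `f` at the successor state after taking `a` in `s`. -/
noncomputable def nextExp (M : MDP S A) (s : S) (a : A) (f : S → ℝ) : ℝ :=
  ∑ s', (M.next s a s').toReal * f s'

lemma sum_next (M : MDP S A) (s : S) (a : A) : ∑ s', (M.next s a s').toReal = 1 := by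
  rw [← ENNReal.toReal_sum fun s' _ => PMF.apply_ne_top _ _]
  rw [← tsum_fintype (L := .unconditional S), PMF.tsum_coe, ENNReal.toReal_one]

lemma nextExp_of_mem (M : MDP S A) {s : S} {a : A} (ha : a ∈ M.avail s) (f : S → ℝ) :
    M.nextExp s a f = ∑ s', (M.trans s a s' : ℝ) * f s' := by
  simp [nextExp, next, ha]

lemma nextExp_mono (M : MDP S A) (s : S) (a : A) {f g : S → ℝ} (h : f ≤ g) :
    M.nextExp s a f ≤ M.nextExp s a g :=
  Finset.sum_le_sum fun s' _ => mul_le_mul_of_nonneg_left (h s') ENNReal.toReal_nonneg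

lemma nextExp_const (M : MDP S A) (s : S) (a : A) (k : ℝ) :
    M.nextExp s a (fun _ => k) = k := by
  rw [nextExp, ← Finset.sum_mul, M.sum_next, one_mul]

lemma nextExp_add (M : MDP S A) (s : S) (a : A) (f g : S → ℝ) :
    M.nextExp s a (f + g) = M.nextExp s a f + M.nextExp s a g := by
  simp [nextExp, mul_add, Finset.sum_add_distrib]

lemma nextExp_smul (M : MDP S A) (s : S) (a : A) (k : ℝ) (f : S → ℝ) :
    M.nextExp s a (k • f) = k * M.nextExp s a f := by
  simp only [nextExp, Pi.smul_apply, smul_eq_mul, Finset.mul_sum]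
  exact Finset.sum_congr rfl fun _ _ => by ring

lemma nextExp_sub (M : MDP S A) (s : S) (a : A) (f g : S → ℝ) :
    M.nextExp s a (f - g) = M.nextExp s a f - M.nextExp s a g := by
  simp [nextExp, mul_sub, Finset.sum_sub_distrib]

/-- No availability of `a` is needed, because `next` sends an unavailable action back to `s`. -/
lemma nextExp_of_isAbsorbing (M : MDP S A) {s : S} (hs : M.IsAbsorbing s) (a : A) (f : S → ℝ) :
    M.nextExp s a f = f s := by
  classical
  have key : ∀ s', (M.next s a s').toReal = if s' = s then 1 else 0 := by
    have h1 : M.next s a s = 1 := by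
      by_cases ha : a ∈ M.avail s
      · simp [next, ha, hs a ha]
      · simp [next, ha]
    intro s'
    split_ifs with h
    · rw [h, h1, ENNReal.toReal_one]
    · have h2 := (PMF.apply_eq_one_iff _ _).mp h1
      have : s' ∉ (M.next s a).support := by rw [h2]; exact h
      rw [(PMF.apply_eq_zero_iff _ _).mpr this, ENNReal.toReal_zero]
  simp [nextExp, key]

variable [Fintype A]

namespace Policy

variable {M : MDP S A} (π : M.Policy)

/-- The mean of `g s` under the decision rule of time `t`. -/
noncomputable def avg (t : ℕ) (g : S → A → ℝ) (s : S) : ℝ := ∑ a, (π.prob t s a : ℝ) * g s a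

/-- The expected value of `f` at the successor state, as a function of the state at time `t`. -/
noncomputable def step (t : ℕ) (f : S → ℝ) : S → ℝ := π.avg t fun s a => M.nextExp s a f

/-- The expected value of `f` at the state at time `n`, as a function of the initial state. -/
noncomputable def iter : ℕ → (S → ℝ) → S → ℝ
  | 0, f => f
  | n + 1, f => iter n (π.step n f)

lemma sum_prob_univ (t : ℕ) (s : S) : ∑ a, (π.prob t s a : ℝ) = 1 := by
  rw [← Finset.sum_subset (Finset.subset_univ (M.avail s))
    (fun a _ ha => by simp [π.prob_eq_zero t s a ha])]
  exact_mod_cast π.sum_prob t s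

lemma avg_mono_of_mem (t : ℕ) {g h : S → A → ℝ} (s : S)
    (H : ∀ a ∈ M.avail s, g s a ≤ h s a) : π.avg t g s ≤ π.avg t h s := by
  refine Finset.sum_le_sum fun a _ => ?_
  by_cases ha : a ∈ M.avail s
  · exact mul_le_mul_of_nonneg_left (H a ha) (NNReal.coe_nonneg _)
  · simp [π.prob_eq_zero t s a ha]

lemma avg_congr_of_mem (t : ℕ) {g h : S → A → ℝ} (s : S)
    (H : ∀ a ∈ M.avail s, g s a = h s a) : π.avg t g s = π.avg t h s :=
  (π.avg_mono_of_mem t s fun a ha => (H a ha).le).antisymm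
    (π.avg_mono_of_mem t s fun a ha => (H a ha).ge)

lemma avg_const (t : ℕ) (f : S → ℝ) : π.avg t (fun s _ => f s) = f := by
  ext s
  rw [avg, ← Finset.sum_mul, π.sum_prob_univ, one_mul]

lemma avg_add (t : ℕ) (g h : S → A → ℝ) : π.avg t (g + h) = π.avg t g + π.avg t h := by
  ext s
  simp [avg, mul_add, Finset.sum_add_distrib]

lemma avg_smul (t : ℕ) (k : ℝ) (g : S → A → ℝ) : π.avg t (k • g) = k • π.avg t g := by
  ext s
  simp only [avg, Pi.smul_apply, smul_eq_mul, Finset.mul_sum]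
  exact Finset.sum_congr rfl fun _ _ => by ring

lemma step_mono (t : ℕ) {f g : S → ℝ} (h : f ≤ g) : π.step t f ≤ π.step t g :=
  fun s => π.avg_mono_of_mem t s fun a _ => M.nextExp_mono s a h

lemma step_const (t : ℕ) (k : ℝ) : π.step t (fun _ => k) = fun _ => k := by
  simp only [step, nextExp_const]
  exact π.avg_const t _

lemma step_add (t : ℕ) (f g : S → ℝ) : π.step t (f + g) = π.step t f + π.step t g := by
  simp only [step, nextExp_add]
  exact π.avg_add t _ _

lemma step_smul (t : ℕ) (k : ℝ) (f : S → ℝ) : π.step t (k • f) = k • π.step t f := by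
  simp only [step, nextExp_smul]
  exact π.avg_smul t _ _

lemma iter_mono (n : ℕ) {f g : S → ℝ} (h : f ≤ g) : π.iter n f ≤ π.iter n g := by
  induction n generalizing f g with
  | zero => exact h
  | succ n ih => exact ih (π.step_mono n h)

lemma iter_const (n : ℕ) (k : ℝ) : π.iter n (fun _ => k) = fun _ => k := by
  induction n with
  | zero => rfl
  | succ n ih => rw [iter, π.step_const, ih]

lemma iter_add (n : ℕ) (f g : S → ℝ) : π.iter n (f + g) = π.iter n f + π.iter n g := by
  induction n generalizing f g with
  | zero => rfl
  | succ n ih => simp only [iter, step_add, ih]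

lemma iter_smul (n : ℕ) (k : ℝ) (f : S → ℝ) : π.iter n (k • f) = k • π.iter n f := by
  induction n generalizing f with
  | zero => rfl
  | succ n ih => simp only [iter, step_smul, ih]

lemma iter_sub (n : ℕ) (f g : S → ℝ) : π.iter n (f - g) = π.iter n f - π.iter n g := by
  have h : f - g = f + (-1 : ℝ) • g := by ext; simp [sub_eq_add_neg]
  rw [h, iter_add, iter_smul]
  ext
  simp [sub_eq_add_neg]

lemma iter_le_const (n : ℕ) {f : S → ℝ} {k : ℝ} (h : ∀ s, f s ≤ k) (s : S) :
    π.iter n f s ≤ k :=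
  (π.iter_mono n (g := fun _ => k) h s).trans_eq (by rw [iter_const])

lemma const_le_iter (n : ℕ) {f : S → ℝ} {k : ℝ} (h : ∀ s, k ≤ f s) (s : S) :
    k ≤ π.iter n f s :=
  le_of_eq_of_le (by rw [iter_const]) (π.iter_mono n (f := fun _ => k) h s)

lemma continuous_iter (n : ℕ) : Continuous (π.iter n) := by
  induction n with
  | zero => exact continuous_id
  | succ n ih =>
    have h : Continuous (π.step n) := by
      unfold step avg nextExp
      fun_prop
    exact ih.comp h

/-! ### From the trajectory measure to the operators -/

variable [MeasurableSpace S] [DiscreteMeasurableSpace S]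
  [MeasurableSpace A] [DiscreteMeasurableSpace A]

instance isProbabilityMeasure_law (s : S) : IsProbabilityMeasure (π.law s) := by
  unfold law
  infer_instance

lemma integral_pair (t : ℕ) (s : S) (g : S → A → ℝ) :
    ∫ p, g p.1 p.2 ∂(π.pair t s).toMeasure = π.avg t g s := by
  rw [pair, ← PMF.toMeasure_map _ _ (Measurable.of_discrete), integral_map
    Measurable.of_discrete.aemeasurable Measurable.of_discrete.aestronglyMeasurable,
    PMF.integral_eq_sum]
  simp [avg, rule]

lemma integral_bind {α β : Type*} [Fintype α] [Fintype β] [MeasurableSpace β]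
    [MeasurableSingletonClass β] (p : PMF α) (q : α → PMF β) (g : β → ℝ) :
    ∫ b, g b ∂(p.bind q).toMeasure = ∑ a, (p a).toReal * ∫ b, g b ∂(q a).toMeasure := by
  simp only [PMF.integral_eq_sum, smul_eq_mul, Finset.mul_sum, PMF.bind_apply, tsum_fintype]
  rw [Finset.sum_comm]
  refine Finset.sum_congr rfl fun b _ => ?_
  rw [ENNReal.toReal_sum fun a _ => ENNReal.mul_ne_top (PMF.apply_ne_top _ _)
    (PMF.apply_ne_top _ _), Finset.sum_mul]
  simp [mul_assoc]

lemma integral_zero (s : S) (g : S → A → ℝ) :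
    ∫ ω, g (ω 0).1 (ω 0).2 ∂(π.law s) = π.avg 0 g s := by
  have h : (π.law s).map (Preorder.frestrictLe (π := fun _ => S × A) 0) =
      (π.pair 0 s).toMeasure.map
        (MeasurableEquiv.piUnique fun _ : Finset.Iic 0 => S × A).symm := by
    rw [law, Kernel.trajMeasure, Measure.map_comp _ _ (by fun_prop), Kernel.traj_map_frestrictLe,
      Kernel.partialTraj_self, Measure.id_comp]
  have e : ∫ ω, g (ω 0).1 (ω 0).2 ∂(π.law s) =
      ∫ x, g (x ⟨0, by simp⟩).1 (x ⟨0, by simp⟩).2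
        ∂((π.law s).map (Preorder.frestrictLe (π := fun _ => S × A) 0)) := by
    rw [integral_map (by fun_prop) Measurable.of_discrete.aestronglyMeasurable]
    rfl
  rw [e, h, integral_map (by fun_prop) Measurable.of_discrete.aestronglyMeasurable,
    ← π.integral_pair]
  rfl

/-- The Markov property in integrated form. `G` sees two consecutive pairs so that absorption, a
statement about transitions, can be derived from it. -/
lemma integral_succ (s : S) (t : ℕ) (G : S → A → S → A → ℝ) :
    ∫ ω, G (ω t).1 (ω t).2 (ω (t + 1)).1 (ω (t + 1)).2 ∂(π.law s) =
      ∫ ω, M.nextExp (ω t).1 (ω t).2 (π.avg (t + 1) (G (ω t).1 (ω t).2)) ∂(π.law s) := by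
  classical
  have h := Kernel.map_frestrictLe_trajMeasure_compProd_eq_map_trajMeasure
    (X := fun _ => S × A) (μ₀ := (π.pair 0 s).toMeasure) (κ := π.kernel) (a := t)
  have : Countable ((i : Finset.Iic t) → S × A) := inferInstance
  let F : ((_i : Finset.Iic t) → S × A) × (S × A) → ℝ := fun q =>
    G (q.1 ⟨t, by simp⟩).1 (q.1 ⟨t, by simp⟩).2 q.2.1 q.2.2
  have hF : Measurable F := Measurable.of_discrete
  have hb : ∃ C, ∀ q, ‖F q‖ ≤ C := by
    obtain ⟨C, hC⟩ := (Set.finite_range fun q => ‖F q‖).bddAbove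
    exact ⟨C, fun q => hC ⟨q, rfl⟩⟩
  obtain ⟨C, hC⟩ := hb
  have e1 : ∫ q, F q ∂((π.law s).map (fun x ↦ (Preorder.frestrictLe t x, x (t + 1)))) =
      ∫ ω, G (ω t).1 (ω t).2 (ω (t + 1)).1 (ω (t + 1)).2 ∂(π.law s) := by
    rw [integral_map (by fun_prop) hF.aestronglyMeasurable]
    rfl
  have : IsProbabilityMeasure ((π.law s).map (Preorder.frestrictLe (π := fun _ => S × A) t)) :=
    Measure.isProbabilityMeasure_map (by fun_prop)
  rw [← e1]
  unfold law
  rw [← h, Measure.integral_compProd]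
  · rw [integral_map (by fun_prop) Measurable.of_discrete.aestronglyMeasurable]
    refine integral_congr_ae (ae_of_all _ fun ω => ?_)
    change ∫ q : S × A, G (ω t).1 (ω t).2 q.1 q.2 ∂((M.next (ω t).1 (ω t).2).bind _).toMeasure = _
    rw [integral_bind]
    simp only [integral_pair, nextExp]
  · exact Integrable.of_bound hF.aestronglyMeasurable C (ae_of_all _ hC)

lemma integral_eq_iter (s : S) (t : ℕ) (g : S → A → ℝ) :
    ∫ ω, g (ω t).1 (ω t).2 ∂(π.law s) = π.iter t (π.avg t g) s := by
  induction t generalizing g with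
  | zero => exact π.integral_zero s g
  | succ t ih =>
    rw [π.integral_succ s t fun _ _ => g, ih fun s a => M.nextExp s a (π.avg (t + 1) g)]
    rfl

open Classical in
/-- The indicator function of a set of states. -/
noncomputable def ind (B : Set S) (s : S) : ℝ := if s ∈ B then 1 else 0

lemma ae_absorbed {B : Set S} (hB : ∀ s ∈ B, M.IsAbsorbing s) (s : S) :
    -- For each `t`, the indicator of leaving `B` between `t` and `t + 1` is nonnegative with zero
    -- mean.
    ∀ᵐ ω ∂(π.law s), ∀ t, (ω t).1 ∈ B → (ω (t + 1)).1 ∈ B := by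
  refine ae_all_iff.mpr fun t => ?_
  have h := π.integral_succ s t fun s _ s' _ => ind B s * ind Bᶜ s'
  have h0 : ∀ s a, M.nextExp s a (π.avg (t + 1) fun s' _ => ind B s * ind Bᶜ s') = 0 := by
    intro s a
    rw [avg_const π (t + 1) fun s' => ind B s * ind Bᶜ s']
    by_cases hs : s ∈ B
    · simp [M.nextExp_of_isAbsorbing (hB s hs), ind, hs]
    · simp [ind, hs, nextExp]
  simp only [h0, MeasureTheory.integral_zero] at h
  rw [integral_eq_zero_iff_of_nonneg] at h
  · filter_upwards [h] with ω hω h1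
    by_contra h2
    simp [ind, h1, h2] at hω
  · intro ω
    simp only [ind, Pi.zero_apply]
    split_ifs <;> simp
  · refine Integrable.of_bound (C := 1) ?_ (ae_of_all _ fun ω => ?_)
    · have h1 : Measurable fun ω : ℕ → S × A => (ω t, ω (t + 1)) := by fun_prop
      exact ((Measurable.of_discrete (f := fun p : (S × A) × (S × A) =>
        ind B p.1.1 * ind Bᶜ p.2.1)).comp h1).aestronglyMeasurable
    · simp only [ind]
      split_ifs <;> simp

lemma measurable_comp_coord (t : ℕ) (g : S → A → ℝ) :
    Measurable fun ω : ℕ → S × A => g (ω t).1 (ω t).2 :=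
  (Measurable.of_discrete (f := fun p : S × A => g p.1 p.2)).comp (measurable_pi_apply t)

/-- By absorption, almost surely the indicator of being in `B` at time `t` converges to the
indicator of ever reaching `B`; dominated convergence does the rest. -/
lemma tendsto_iter_ind {B : Set S} (hB : ∀ s ∈ B, M.IsAbsorbing s) (s : S) :
    Tendsto (fun t => π.iter t (ind B) s) atTop (𝓝 (π.reachProb B s)) := by
  have h1 : ∀ t, π.iter t (ind B) s = ∫ ω, ind B (ω t).1 ∂(π.law s) := fun t => by
    rw [π.integral_eq_iter s t fun s _ => ind B s, avg_const]
  have hms : MeasurableSet {ω : ℕ → S × A | ∃ t, (ω t).1 ∈ B} := by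
    rw [Set.ofPred_exists]
    refine MeasurableSet.iUnion fun t => ?_
    exact (measurable_fst.comp (measurable_pi_apply t)) (.of_discrete (s := B))
  have h2 : π.reachProb B s =
      ∫ ω, {ω : ℕ → S × A | ∃ t, (ω t).1 ∈ B}.indicator 1 ω ∂(π.law s) := by
    rw [integral_indicator_one hms, reachProb]
  simp only [h1, h2]
  refine tendsto_integral_of_dominated_convergence (fun _ => 1)
    (fun t => (measurable_comp_coord t fun s _ => ind B s).aestronglyMeasurable)
    (integrable_const _) (fun t => ae_of_all _ fun ω => ?_) ?_
  · simp only [ind]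
    split_ifs <;> simp
  · filter_upwards [π.ae_absorbed hB s] with ω hω
    by_cases h : ∃ t, (ω t).1 ∈ B
    · obtain ⟨t, ht⟩ := h
      refine tendsto_const_nhds.congr' ?_
      filter_upwards [eventually_ge_atTop t] with n hn
      have : (ω n).1 ∈ B := Nat.le_induction ht (fun k _ => hω k) n hn
      rw [Set.indicator_of_mem (show ω ∈ {ω : ℕ → S × A | ∃ t, (ω t).1 ∈ B} from ⟨t, ht⟩)]
      simp [ind, this]
    · rw [Set.indicator_of_notMem
        (show ω ∉ {ω : ℕ → S × A | ∃ t, (ω t).1 ∈ B} from h)]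
      push Not at h
      simp [ind, h]

lemma hasSum_cost (c : S → A → ℝ≥0) {β : ℝ} (hβ₀ : 0 < β) (hβ₁ : β < 1) :
    HasSum (fun t => β ^ t * π.iter t (π.avg t fun s a => c s a) M.init) (π.cost c β) := by
  obtain ⟨C, hC⟩ := (Set.finite_range fun p : S × A => (c p.1 p.2 : ℝ)).bddAbove
  have hC : ∀ s a, (c s a : ℝ) ≤ C := fun s a => hC ⟨(s, a), rfl⟩
  have hm : ∀ t, Measurable fun ω : ℕ → S × A => β ^ t * (c (ω t).1 (ω t).2 : ℝ) := fun t =>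
    (measurable_comp_coord t fun s a => (c s a : ℝ)).const_mul _
  have hb : ∀ t (ω : ℕ → S × A), ‖β ^ t * (c (ω t).1 (ω t).2 : ℝ)‖ ≤ β ^ t * C := by
    intro t ω
    rw [Real.norm_of_nonneg (by positivity)]
    exact mul_le_mul_of_nonneg_left (hC _ _) (by positivity)
  have hi : ∀ t, Integrable (fun ω : ℕ → S × A => β ^ t * (c (ω t).1 (ω t).2 : ℝ))
      (π.law M.init) := fun t =>
    Integrable.of_bound (hm t).aestronglyMeasurable _ (ae_of_all _ (hb t))
  have hs : Summable fun t : ℕ => β ^ t * C :=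
    (summable_geometric_of_lt_one hβ₀.le hβ₁).mul_right C
  have h := hasSum_integral_of_summable_integral_norm hi (hs.of_nonneg_of_le
    (fun t => integral_nonneg fun ω => norm_nonneg _) fun t =>
      (integral_mono (hi t).norm (integrable_const _) (hb t)).trans_eq (by simp))
  refine h.congr_fun ?_
  intro t
  rw [integral_const_mul, π.integral_eq_iter M.init t fun s a => (c s a : ℝ)]

end Policy
end MDP

/-! ### Stationary policies, switching, and reachability probabilities -/

namespace MDP

variable {S A : Type*} [Fintype S]

namespace Policy

variable {M : MDP S A}

open Classical in
/-- The stationary policy that takes the action `d s` in the state `s`. -/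
noncomputable def ofRule (d : S → A) (hd : ∀ s, d s ∈ M.avail s) : M.Policy where
  prob _ s a := if a = d s then 1 else 0
  sum_prob t s := by simp [hd s]
  prob_eq_zero t s a ha := if_neg fun h => ha (by rw [h]; exact hd s)

/-- The policy that follows `π` up to time `T` and `σ`, with its own clock, from then on. -/
def switch (π σ : M.Policy) (T : ℕ) : M.Policy where
  prob t := if t < T then π.prob t else σ.prob (t - T)
  sum_prob t s := by split_ifs; exacts [π.sum_prob _ s, σ.sum_prob _ s]
  prob_eq_zero t s a ha := by
    split_ifs; exacts [π.prob_eq_zero _ s a ha, σ.prob_eq_zero _ s a ha]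

variable [Fintype A]

lemma avg_ofRule (d : S → A) (hd : ∀ s, d s ∈ M.avail s) (t : ℕ) (g : S → A → ℝ) (s : S) :
    (ofRule d hd).avg t g s = g s (d s) := by
  rw [avg, Finset.sum_eq_single (d s) (fun a _ ha => by simp [ofRule, ha]) (by simp)]
  simp [ofRule]

lemma step_ofRule (d : S → A) (hd : ∀ s, d s ∈ M.avail s) (t : ℕ) (f : S → ℝ) (s : S) :
    (ofRule d hd).step t f s = M.nextExp s (d s) f :=
  avg_ofRule d hd t _ s

lemma iter_ofRule_succ (d : S → A) (hd : ∀ s, d s ∈ M.avail s) (n : ℕ) (f : S → ℝ) (s : S) :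
    (ofRule d hd).iter (n + 1) f s = M.nextExp s (d s) ((ofRule d hd).iter n f) := by
  induction n generalizing f with
  | zero => exact step_ofRule d hd 0 f s
  | succ n ih =>
    have h : (ofRule d hd).step (n + 1) f = (ofRule d hd).step n f := by
      ext s
      rw [step_ofRule, step_ofRule]
    rw [iter, ih, h]
    rfl

lemma iter_switch_of_le (π σ : M.Policy) {T n : ℕ} (h : n ≤ T) (f : S → ℝ) :
    (π.switch σ T).iter n f = π.iter n f := by
  induction n generalizing f with
  | zero => rfl
  | succ n ih =>
    rw [iter, ih (by omega), iter]
    congr 1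
    ext s
    simp [step, avg, switch, show n < T by omega]

lemma avg_switch_of_lt (π σ : M.Policy) {T n : ℕ} (h : n < T) (g : S → A → ℝ) :
    (π.switch σ T).avg n g = π.avg n g := by
  ext s
  simp [avg, switch, h]

lemma iter_switch_add (π σ : M.Policy) (T n : ℕ) (f : S → ℝ) :
    (π.switch σ T).iter (T + n) f = π.iter T (σ.iter n f) := by
  induction n generalizing f with
  | zero => exact iter_switch_of_le π σ le_rfl f
  | succ n ih =>
    rw [← add_assoc, iter, ih, iter]
    congr 2
    ext s
    simp [step, avg, switch]

lemma iter_le_of_step_le (π : M.Policy) {f : S → ℝ} (h : ∀ t, π.step t f ≤ f) (n : ℕ) :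
    π.iter n f ≤ f := by
  induction n with
  | zero => exact le_rfl
  | succ n ih => exact (π.iter_mono n (h n)).trans ih

lemma step_le_of_nextExp_le (π : M.Policy) {f : S → ℝ}
    (h : ∀ s, ∀ a ∈ M.avail s, M.nextExp s a f ≤ f s) (t : ℕ) : π.step t f ≤ f := by
  intro s
  conv_rhs => rw [← π.avg_const t f]
  exact π.avg_mono_of_mem t s (h s)

lemma ind_nonneg {S : Type*} (B : Set S) (s : S) : 0 ≤ ind B s := by
  unfold ind; split_ifs <;> norm_num

lemma ind_le_step {B : Set S} (hB : ∀ s ∈ B, M.IsAbsorbing s) (π : M.Policy) (t : ℕ) :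
    ind B ≤ π.step t (ind B) := by
  intro s
  conv_lhs => rw [← π.avg_const t (ind B)]
  refine π.avg_mono_of_mem t s fun a _ => ?_
  by_cases hs : s ∈ B
  · rw [M.nextExp_of_isAbsorbing (hB s hs)]
  · simp only [ind, if_neg hs]
    exact (M.nextExp_const s a 0).symm.trans_le (M.nextExp_mono s a (ind_nonneg B))

variable [MeasurableSpace S] [DiscreteMeasurableSpace S]
  [MeasurableSpace A] [DiscreteMeasurableSpace A]

variable {B : Set S} (hB : ∀ s ∈ B, M.IsAbsorbing s) (π : M.Policy)

lemma reachProb_nonneg (s : S) : 0 ≤ π.reachProb B s := measureReal_nonneg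

lemma reachProb_le_one (s : S) : π.reachProb B s ≤ 1 := measureReal_le_one

include hB in
lemma iter_ind_le_reachProb (t : ℕ) (s : S) : π.iter t (ind B) s ≤ π.reachProb B s :=
  (monotone_nat_of_le_succ fun t => π.iter_mono t (ind_le_step hB π t) s).ge_of_tendsto
    (π.tendsto_iter_ind hB s) t

include hB in
lemma reachProb_of_mem {s : S} (hs : s ∈ B) : π.reachProb B s = 1 := by
  refine (π.reachProb_le_one s).antisymm ?_
  simpa [iter, ind, hs] using π.iter_ind_le_reachProb hB 0 s

include hB in
-- An excessive majorant of the indicator stays above all of its iterates, hence above their limit.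
lemma reachProb_le_of_nextExp_le {f : S → ℝ} (hf : ind B ≤ f)
    (h : ∀ s, ∀ a ∈ M.avail s, M.nextExp s a f ≤ f s) (s : S) : π.reachProb B s ≤ f s :=
  le_of_tendsto (π.tendsto_iter_ind hB s) (Eventually.of_forall fun n =>
    (π.iter_mono n hf s).trans (π.iter_le_of_step_le (π.step_le_of_nextExp_le h) n s))

include hB in
lemma reachProb_switch (σ : M.Policy) (T : ℕ) (s : S) :
    (π.switch σ T).reachProb B s = π.iter T (σ.reachProb B) s := by
  refine tendsto_nhds_unique (((π.switch σ T).tendsto_iter_ind hB s).comp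
    (tendsto_add_atTop_nat T)) ?_
  have h1 : Tendsto (fun n => σ.iter n (ind B)) atTop (𝓝 (σ.reachProb B)) :=
    tendsto_pi_nhds.mpr (σ.tendsto_iter_ind hB)
  have h2 := tendsto_pi_nhds.mp (((π.continuous_iter T).tendsto _).comp h1) s
  refine h2.congr fun n => ?_
  rw [Function.comp_apply, Function.comp_apply, add_comm n T, iter_switch_add]

include hB in
-- First-step analysis: stationarity lets the first step be split off (`iter_ofRule_succ`), and the
-- limit passes through the finite sum.
lemma nextExp_reachProb_ofRule (d : S → A) (hd : ∀ s, d s ∈ M.avail s) (s : S) :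
    M.nextExp s (d s) ((ofRule d hd).reachProb B) = (ofRule d hd).reachProb B s := by
  have h1 : Tendsto (fun n => (ofRule d hd).iter n (ind B)) atTop
      (𝓝 ((ofRule d hd).reachProb B)) :=
    tendsto_pi_nhds.mpr ((ofRule d hd).tendsto_iter_ind hB)
  have h2 : Continuous (M.nextExp s (d s)) := by unfold nextExp; fun_prop
  refine tendsto_nhds_unique ((h2.tendsto _).comp h1) ?_
  refine (((ofRule d hd).tendsto_iter_ind hB s).comp (tendsto_add_atTop_nat 1)).congr fun n => ?_
  exact iter_ofRule_succ d hd n _ s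

end Policy

/-! ### Policy improvement and the optimality equation for reachability -/

open Policy

/-- Maximum principle: an average of values at most `m` reaches `m` only if no weight falls on
smaller values. -/
lemma nextExp_eq_max {M : MDP S A} {s : S} {a : A} {y : S → ℝ} {m : ℝ} (hy : ∀ s, y s ≤ m)
    (h : m ≤ M.nextExp s a y) {s' : S} (hs' : y s' ≠ m) : (M.next s a s').toReal = 0 := by
  have h0 : ∑ s', (M.next s a s').toReal * (m - y s') = m - M.nextExp s a y := by
    simp only [mul_sub, Finset.sum_sub_distrib, ← Finset.sum_mul, M.sum_next, one_mul, nextExp]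
  have hn : ∀ s' ∈ Finset.univ, 0 ≤ (M.next s a s').toReal * (m - y s') := fun s' _ =>
    mul_nonneg ENNReal.toReal_nonneg (sub_nonneg.mpr (hy s'))
  have h1 := (Finset.sum_eq_zero_iff_of_nonneg hn).mp
    ((h0.trans_le (by linarith)).antisymm (Finset.sum_nonneg hn)) s' (Finset.mem_univ _)
  exact (mul_eq_zero.mp h1).resolve_right (sub_ne_zero.mpr hs'.symm)

variable [Fintype A] [MeasurableSpace S] [DiscreteMeasurableSpace S]
  [MeasurableSpace A] [DiscreteMeasurableSpace A]

/-- Policy improvement for reachability: switching a stationary policy in one state to an action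
with a larger expected value raises the value there and lowers it nowhere. -/
lemma reachProb_improve {M : MDP S A} {B : Set S} (hB : ∀ s ∈ B, M.IsAbsorbing s)
    (d d' : S → A) (hd : ∀ s, d s ∈ M.avail s) (hd' : ∀ s, d' s ∈ M.avail s) (s₀ : S)
    (heq : ∀ s, s ≠ s₀ → d' s = d s)
    (hlt : (ofRule d hd).reachProb B s₀ < M.nextExp s₀ (d' s₀) ((ofRule d hd).reachProb B)) :
    (ofRule d hd).reachProb B ≤ (ofRule d' hd').reachProb B ∧
      (ofRule d hd).reachProb B s₀ < (ofRule d' hd').reachProb B s₀ := by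
  set h := (ofRule d hd).reachProb B with h_def
  set h' := (ofRule d' hd').reachProb B with h'_def
  have hfix : ∀ s, M.nextExp s (d s) h = h s := nextExp_reachProb_ofRule hB d hd
  have hfix' : ∀ s, M.nextExp s (d' s) h' = h' s := nextExp_reachProb_ofRule hB d' hd'
  have hstep : ∀ s, h s ≤ M.nextExp s (d' s) h := by
    intro s
    by_cases hs : s = s₀
    · subst hs; exact hlt.le
    · rw [heq s hs, hfix]
  have hy : ∀ s, (h - h') s ≤ M.nextExp s (d' s) (h - h') := by
    intro s
    rw [nextExp_sub, hfix', Pi.sub_apply]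
    linarith [hstep s]
  -- `h - h'` is subharmonic for `d'`. If its maximum were positive, the set of maximizers would be
  -- closed under `d'`, avoid `s₀` (where the inequality is strict) and avoid `B` (where the
  -- difference is zero). On it `d'` agrees with `d`, so `d` never reaches `B` from there and `h`
  -- vanishes, contradicting `h > h' ≥ 0`.
  have hle : h ≤ h' := by
    have : Nonempty S := ⟨s₀⟩
    obtain ⟨s₁, hs₁⟩ := Finite.exists_max (h - h')
    by_contra hcon
    have hpos : 0 < (h - h') s₁ := by
      by_contra hneg
      push Not at hneg
      exact hcon fun s => by have := hs₁ s; simp only [Pi.sub_apply] at this hneg; linarith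
    set m := (h - h') s₁ with hm
    have hsucc : ∀ s, (h - h') s = m → ∀ s', (h - h') s' ≠ m →
        (M.next s (d' s) s').toReal = 0 := fun s hs s' hs' =>
      nextExp_eq_max hs₁ (hs ▸ hy s) hs'
    have hne : ∀ s, (h - h') s = m → s ≠ s₀ := by
      rintro s hs rfl
      have h1 : (h - h') s < M.nextExp s (d' s) (h - h') := by
        rw [nextExp_sub, hfix', Pi.sub_apply]
        linarith
      have h2 := (M.nextExp_mono s (d' s) (g := fun _ => m) hs₁).trans_eq (M.nextExp_const ..)
      linarith
    have hzero : ∀ n s, (h - h') s = m → (ofRule d hd).iter n (ind B) s = 0 := by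
      intro n
      induction n with
      | zero =>
        intro s hs
        by_cases hsB : s ∈ B
        · have h1 : (h - h') s = 0 := by
            rw [Pi.sub_apply, h_def, h'_def, reachProb_of_mem hB _ hsB,
              reachProb_of_mem hB _ hsB, sub_self]
          linarith
        · simp [iter, ind, hsB]
      | succ n ih =>
        intro s hs
        rw [iter_ofRule_succ, ← heq s (hne s hs)]
        refine Finset.sum_eq_zero fun s' _ => ?_
        by_cases hs' : (h - h') s' = m
        · rw [ih s' hs', mul_zero]
        · rw [hsucc s hs s' hs', zero_mul]
    have h0 : h s₁ = 0 := by
      refine tendsto_nhds_unique ((ofRule d hd).tendsto_iter_ind hB s₁) ?_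
      simp only [hzero _ s₁ rfl, tendsto_const_nhds]
    have h1 : 0 ≤ h' s₁ := reachProb_nonneg _ _
    rw [hm, Pi.sub_apply] at hpos
    linarith
  exact ⟨hle, hlt.trans_le ((M.nextExp_mono _ _ hle).trans_eq (hfix' s₀))⟩

/-- Some stationary policy has an excessive reachability function. -/
lemma exists_ofRule_nextExp_le (M : MDP S A) (hM : ∀ s, (M.avail s).Nonempty) {B : Set S}
    (hB : ∀ s ∈ B, M.IsAbsorbing s) : ∃ (d : S → A) (hd : ∀ s, d s ∈ M.avail s),
      ∀ s, ∀ a ∈ M.avail s,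
        M.nextExp s a ((ofRule d hd).reachProb B) ≤ (ofRule d hd).reachProb B s := by
  classical
  have : Nonempty {d : S → A // ∀ s, d s ∈ M.avail s} :=
    ⟨fun s => (hM s).choose, fun s => (hM s).choose_spec⟩
  -- Maximizing the sum over all states gives one rule for all of them: an improvement in one state
  -- lowers no value, so it would raise the sum.
  obtain ⟨⟨d, hd⟩, hmax⟩ := Finite.exists_max
    fun d : {d : S → A // ∀ s, d s ∈ M.avail s} => ∑ s, (ofRule d.1 d.2).reachProb B s
  refine ⟨d, hd, fun s₀ a ha => ?_⟩
  by_contra! hlt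
  have hd' : ∀ s, Function.update d s₀ a s ∈ M.avail s := by
    intro s
    by_cases hs : s = s₀
    · subst hs; simpa using ha
    · simpa [hs] using hd s
  obtain ⟨h1, h2⟩ := reachProb_improve hB d (Function.update d s₀ a) hd hd' s₀
    (fun s hs => by simp [hs]) (by simpa using hlt)
  exact (Finset.sum_lt_sum (fun s _ => h1 s) ⟨s₀, Finset.mem_univ _, h2⟩).not_ge (hmax ⟨_, hd'⟩)

variable {M : MDP S A} {B : Set S}

lemma reachProb_le_maxReach (π : M.Policy) (s : S) : π.reachProb B s ≤ M.maxReach B s :=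
  le_ciSup (f := fun π : M.Policy => π.reachProb B s)
    ⟨1, by rintro _ ⟨π, rfl⟩; exact π.reachProb_le_one s⟩ π

/-- The maximum reachability probabilities are attained by one stationary policy from all states,
and they solve the optimality equations. -/
lemma exists_reachProb_eq_maxReach (hM : ∀ s, (M.avail s).Nonempty)
    (hB : ∀ s ∈ B, M.IsAbsorbing s) :
    (∃ σ : M.Policy, σ.reachProb B = M.maxReach B) ∧
    (∀ s, ∀ a ∈ M.avail s, M.nextExp s a (M.maxReach B) ≤ M.maxReach B s) ∧
    ∀ s, ∃ a ∈ M.avail s, M.nextExp s a (M.maxReach B) = M.maxReach B s := by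
  obtain ⟨d, hd, h⟩ := exists_ofRule_nextExp_le M hM hB
  have hx : (ofRule d hd).reachProb B = M.maxReach B := by
    ext s
    refine (reachProb_le_maxReach _ s).antisymm ?_
    have : Nonempty M.Policy := ⟨ofRule d hd⟩
    exact ciSup_le fun π => π.reachProb_le_of_nextExp_le hB
      (iter_ind_le_reachProb hB (ofRule d hd) 0) h s
  refine ⟨⟨_, hx⟩, hx ▸ h, fun s => ⟨d s, hd s, ?_⟩⟩
  rw [← hx]
  exact nextExp_reachProb_ofRule hB d hd s

end MDP

/-! ### Comparison and continuity of discounted costs -/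

namespace MDP

variable {S A : Type*} [Fintype S] [Fintype A] {M : MDP S A}

namespace Policy

variable (π : M.Policy)

lemma iter_eq_zero_of_support {n : ℕ} {s : S} {f g : S → ℝ} (hf : 0 ≤ f)
    (h0 : π.iter n f s = 0) (hfg : ∀ s, g s ≠ 0 → 0 < f s) : π.iter n g s = 0 := by
  -- Finiteness of `S` gives a bound `|g| ≤ C • f`; where `f` vanishes so does `g`.
  obtain ⟨C, hC⟩ := (Set.finite_range fun s => |g s| / f s).bddAbove
  have hb : ∀ s, |g s| ≤ (C • f) s := by
    intro s
    by_cases hs : g s = 0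
    · have h1 : 0 ≤ C := (div_nonneg (abs_nonneg (g s)) (hf s)).trans (hC ⟨s, rfl⟩)
      rw [hs, abs_zero]
      exact mul_nonneg h1 (hf s)
    · exact (div_le_iff₀ (hfg s hs)).mp (hC ⟨s, rfl⟩)
  have h1 := π.iter_mono n (f := g) (g := C • f) (fun s => (le_abs_self _).trans (hb s)) s
  have h2 := π.iter_mono n (f := (-C) • f) (g := g)
    (fun s => by have := neg_abs_le (g s); have := hb s; simp at *; linarith) s
  rw [iter_smul, Pi.smul_apply, h0, smul_zero] at h1 h2
  exact h1.antisymm h2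

variable [MeasurableSpace S] [DiscreteMeasurableSpace S]
  [MeasurableSpace A] [DiscreteMeasurableSpace A]

/-- Two policies, possibly of different processes with the same initial state, have the same cost
if they agree along the trajectories of the first one. -/
lemma cost_congr {N : MDP S A} (hinit : N.init = M.init) (π : M.Policy) (ρ : N.Policy)
    (h : ∀ t (gM gN : S → A → ℝ), (∀ s, ∀ a ∈ M.avail s, a ∈ N.avail s → gM s a = gN s a) →
      π.iter t (π.avg t gM) M.init = π.iter t (ρ.avg t gN) M.init)
    (htrans : ∀ s, ∀ a ∈ M.avail s, a ∈ N.avail s → ∀ f, M.nextExp s a f = N.nextExp s a f)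
    (c : S → A → ℝ≥0) {β : ℝ} (hβ₀ : 0 < β) (hβ₁ : β < 1) : π.cost c β = ρ.cost c β := by
  -- Applied to the one-step expectations of `f`, the hypothesis `h` at time `t` carries the
  -- agreement over to time `t + 1`.
  have hiter : ∀ t f, π.iter t f M.init = ρ.iter t f M.init := by
    intro t
    induction t with
    | zero => intro f; rfl
    | succ t ih =>
      intro f
      rw [iter, iter, ← ih]
      exact h t _ _ fun s a ha ha' => htrans s a ha ha' f
  refine (π.hasSum_cost c hβ₀ hβ₁).unique ((ρ.hasSum_cost c hβ₀ hβ₁).congr_fun fun t => ?_)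
  rw [hinit, ← hiter, ← h t _ _ fun s a _ _ => rfl]

/-- A bounded terminal payoff `W` at time `n` is discounted away. If `W` satisfies a one-sided
Bellman inequality, these truncated costs are monotone in `n` and start at `W M.init`, which gives
the two comparison lemmas below. -/
lemma tendsto_sum_cost (c : S → A → ℝ≥0) {β : ℝ} (hβ₀ : 0 < β) (hβ₁ : β < 1) (W : S → ℝ) :
    Tendsto (fun n => (∑ t ∈ Finset.range n,
        β ^ t * π.iter t (π.avg t fun s a => c s a) M.init) + β ^ n * π.iter n W M.init)
      atTop (𝓝 (π.cost c β)) := by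
  have h1 := (π.hasSum_cost c hβ₀ hβ₁).tendsto_sum_nat
  obtain ⟨C, hC⟩ := (Set.finite_range fun s => |W s|).bddAbove
  have hC : ∀ s, |W s| ≤ C := fun s => hC ⟨s, rfl⟩
  have h2 : Tendsto (fun n => β ^ n * π.iter n W M.init) atTop (𝓝 0) := by
    refine squeeze_zero_norm (a := fun n => β ^ n * C) (fun n => ?_) ?_
    · rw [norm_mul, Real.norm_of_nonneg (by positivity)]
      refine mul_le_mul_of_nonneg_left (abs_le.mpr ⟨?_, ?_⟩) (by positivity)
      · exact π.const_le_iter n (fun s => (abs_le.mp (hC s)).1) _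
      · exact π.iter_le_const n (fun s => (abs_le.mp (hC s)).2) _
    · simpa using (tendsto_pow_atTop_nhds_zero_of_lt_one hβ₀.le hβ₁).mul_const C
  simpa using h1.add h2

lemma le_cost_of_le (c : S → A → ℝ≥0) {β : ℝ} (hβ₀ : 0 < β) (hβ₁ : β < 1) (W : S → ℝ)
    (h : ∀ t, W ≤ π.avg t (fun s a => c s a) + β • π.step t W) : W M.init ≤ π.cost c β := by
  refine ge_of_tendsto (π.tendsto_sum_cost c hβ₀ hβ₁ W) (Eventually.of_forall fun n => ?_)
  induction n with
  | zero => simp [iter]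
  | succ n ih =>
    have h1 := mul_le_mul_of_nonneg_left (π.iter_mono n (h n) M.init) (pow_nonneg hβ₀.le n)
    rw [iter_add, iter_smul] at h1
    simp only [Pi.add_apply, Pi.smul_apply, smul_eq_mul] at h1
    rw [Finset.sum_range_succ, iter, pow_succ]
    linarith

lemma cost_le_of_le (c : S → A → ℝ≥0) {β : ℝ} (hβ₀ : 0 < β) (hβ₁ : β < 1) (W : S → ℝ)
    (h : ∀ t, π.avg t (fun s a => c s a) + β • π.step t W ≤ W) : π.cost c β ≤ W M.init := by
  refine le_of_tendsto (π.tendsto_sum_cost c hβ₀ hβ₁ W) (Eventually.of_forall fun n => ?_)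
  induction n with
  | zero => simp [iter]
  | succ n ih =>
    have h1 := mul_le_mul_of_nonneg_left (π.iter_mono n (h n) M.init) (pow_nonneg hβ₀.le n)
    rw [iter_add, iter_smul] at h1
    simp only [Pi.add_apply, Pi.smul_apply, smul_eq_mul] at h1
    rw [Finset.sum_range_succ, iter, pow_succ]
    linarith

/-- The term of time `t` does not change once `T > t`, and a geometric series dominates all terms
uniformly in `T`. -/
lemma tendsto_cost_switch (σ : M.Policy) (c : S → A → ℝ≥0) {β : ℝ} (hβ₀ : 0 < β) (hβ₁ : β < 1) :
    Tendsto (fun T => (π.switch σ T).cost c β) atTop (𝓝 (π.cost c β)) := by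
  obtain ⟨C, hC⟩ := (Set.finite_range fun p : S × A => (c p.1 p.2 : ℝ)).bddAbove
  have hC : ∀ s a, (c s a : ℝ) ≤ C := fun s a => hC ⟨(s, a), rfl⟩
  have hs : Summable fun t : ℕ => β ^ t * C :=
    (summable_geometric_of_lt_one hβ₀.le hβ₁).mul_right C
  simp only [← (hasSum_cost _ c hβ₀ hβ₁).tsum_eq]
  refine tendsto_tsum_of_dominated_convergence hs (fun t => ?_)
    (Eventually.of_forall fun T t => ?_)
  · refine tendsto_const_nhds.congr' ?_
    filter_upwards [eventually_gt_atTop t] with T hT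
    rw [avg_switch_of_lt π σ hT, iter_switch_of_le π σ hT.le]
  · rw [norm_mul, Real.norm_of_nonneg (by positivity)]
    have h1 : ∀ s, (π.switch σ T).avg t (fun s a => (c s a : ℝ)) s ≤ C := fun s =>
      ((π.switch σ T).avg_mono_of_mem t (h := fun _ _ => C) s fun a _ => hC s a).trans_eq
        (congrFun (avg_const _ t fun _ => C) s)
    have h2 : ∀ s, 0 ≤ (π.switch σ T).avg t (fun s a => (c s a : ℝ)) s := fun s =>
      Finset.sum_nonneg fun a _ => by positivity
    rw [Real.norm_of_nonneg (const_le_iter _ t h2 _)]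
    exact mul_le_mul_of_nonneg_left (iter_le_const _ t h1 _) (by positivity)

end Policy

/-! ### Optimal policies for the discounted cost -/

open Policy

/-- The optimality equation of the discounted cost has a solution. -/
lemma exists_bellman_solution {S A : Type*} [Fintype S] (M : MDP S A) (hM : ∀ s, (M.avail s).Nonempty)
    (c : S → A → ℝ≥0) {β : ℝ} (hβ₀ : 0 < β) (hβ₁ : β < 1) :
    ∃ W : S → ℝ, ∀ s, (M.avail s).inf' (hM s) (fun a => c s a + β * M.nextExp s a W) = W s := by
  obtain ⟨b, rfl⟩ : ∃ b : ℝ≥0, (b : ℝ) = β := ⟨β.toNNReal, Real.coe_toNNReal _ hβ₀.le⟩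
  let T : (S → ℝ) → S → ℝ := fun W s =>
    (M.avail s).inf' (hM s) fun a => c s a + b * M.nextExp s a W
  -- An action optimal for `W` is a competitor for `V`; exchanging `V` and `W` then gives the
  -- contraction.
  have key : ∀ V W s, T V s ≤ T W s + b * dist V W := by
    intro V W s
    obtain ⟨a, ha, he⟩ := Finset.exists_mem_eq_inf' (hM s) fun a => c s a + b * M.nextExp s a W
    have h1 : T V s ≤ c s a + b * M.nextExp s a V := Finset.inf'_le _ ha
    have h2 : M.nextExp s a V ≤ M.nextExp s a W + dist V W := by
      have h3 : V ≤ W + fun _ => dist V W := fun s => by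
        have h4 := (le_abs_self _).trans (dist_le_pi_dist V W s)
        simp only [Pi.add_apply]
        linarith
      have h5 := M.nextExp_mono s a h3
      rwa [nextExp_add, nextExp_const] at h5
    have h6 := mul_le_mul_of_nonneg_left h2 hβ₀.le
    change T V s ≤ (M.avail s).inf' (hM s) _ + _
    rw [he]
    linarith
  have hT : ContractingWith b T := by
    refine ⟨by exact_mod_cast hβ₁, LipschitzWith.of_dist_le_mul fun V W => ?_⟩
    refine (dist_pi_le_iff (by positivity)).mpr fun s => abs_le.mpr ⟨?_, ?_⟩
    · have := key W V s
      rw [dist_comm] at this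
      linarith
    · have := key V W s
      linarith
  exact ⟨hT.fixedPoint T, fun s => congrFun hT.fixedPoint_isFixedPt s⟩

variable [MeasurableSpace S] [DiscreteMeasurableSpace S]
  [MeasurableSpace A] [DiscreteMeasurableSpace A]

lemma exists_cost_le (M : MDP S A) (hM : ∀ s, (M.avail s).Nonempty)
    (c : S → A → ℝ≥0) {β : ℝ} (hβ₀ : 0 < β) (hβ₁ : β < 1) :
    ∃ σ : M.Policy, ∀ π : M.Policy, σ.cost c β ≤ π.cost c β := by
  obtain ⟨W, hW⟩ := M.exists_bellman_solution hM c hβ₀ hβ₁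
  choose d hd he using fun s =>
    Finset.exists_mem_eq_inf' (hM s) fun a => c s a + β * M.nextExp s a W
  have hstep : ∀ (π : M.Policy) t, π.avg t (fun s a => c s a) + β • π.step t W =
      π.avg t fun s a => c s a + β * M.nextExp s a W := fun π t => by
    rw [step, ← avg_smul, ← avg_add]
    rfl
  refine ⟨ofRule d hd, fun π => le_trans (b := W M.init) ?_ ?_⟩
  · refine cost_le_of_le _ c hβ₀ hβ₁ W fun t s => ?_
    rw [hstep, avg_ofRule, ← he, hW]
  · refine le_cost_of_le _ c hβ₀ hβ₁ W fun t s => ?_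
    rw [hstep]
    conv_lhs => rw [← π.avg_const t W]
    refine π.avg_mono_of_mem t s fun a ha => ?_
    rw [← hW s]
    exact Finset.inf'_le _ ha

/-! ### The cleaned-up process and the transfer of policies -/

variable {B : Set S}

lemma cleanUp_avail_subset (M : MDP S A) (B : Set S) (s : S) :
    (M.cleanUp B).avail s ⊆ M.avail s := by
  intro a ha
  simp only [cleanUp] at ha
  split_ifs at ha
  · exact (Finset.mem_filter.mp ha).1
  · exact ha

lemma nextExp_cleanUp {s : S} {a : A} (ha : a ∈ (M.cleanUp B).avail s) (f : S → ℝ) :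
    (M.cleanUp B).nextExp s a f = M.nextExp s a f := by
  rw [nextExp_of_mem _ ha, nextExp_of_mem _ (M.cleanUp_avail_subset B s ha)]
  rfl

/-- Outside `remStates` nothing is removed, and indeed every available action preserves the maximum
there: states of `B` are absorbing, and where the maximum is zero, excessivity forces a zero mean.
So a single criterion describes all states. -/
lemma mem_cleanUp_avail_iff (hM : ∀ s, (M.avail s).Nonempty) (hB : ∀ s ∈ B, M.IsAbsorbing s)
    {s : S} {a : A} (ha : a ∈ M.avail s) :
    a ∈ (M.cleanUp B).avail s ↔ M.nextExp s a (M.maxReach B) = M.maxReach B s := by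
  obtain ⟨⟨σ, hσ⟩, hle, -⟩ := exists_reachProb_eq_maxReach hM hB
  by_cases hs : s ∈ M.remStates B
  · simp [cleanUp, hs, maxActions, ha, M.nextExp_of_mem ha, eq_comm]
  · simp only [cleanUp, hs, if_false, ha, true_iff]
    rw [remStates, Set.notMem_compl_iff] at hs
    rcases hs with hs | hs
    · exact M.nextExp_of_isAbsorbing (hB s hs) a _
    · have h0 : M.maxReach B s = 0 := by rw [← hσ]; exact hs σ
      refine (hle s a ha).antisymm ?_
      rw [h0]
      refine (M.nextExp_const s a 0).symm.trans_le (M.nextExp_mono s a fun s' => ?_)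
      rw [← hσ]
      exact σ.reachProb_nonneg s'

lemma cleanUp_avail_nonempty (hM : ∀ s, (M.avail s).Nonempty) (hB : ∀ s ∈ B, M.IsAbsorbing s)
    (s : S) : ((M.cleanUp B).avail s).Nonempty := by
  obtain ⟨a, ha, h⟩ := (exists_reachProb_eq_maxReach hM hB).2.2 s
  exact ⟨a, (mem_cleanUp_avail_iff hM hB ha).mpr h⟩

namespace Policy

/-- A policy of the cleaned-up process as a policy of the original one. -/
def ofCleanUp (ρ : (M.cleanUp B).Policy) : M.Policy where
  prob := ρ.prob
  sum_prob t s := by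
    rw [← ρ.sum_prob t s]
    exact (Finset.sum_subset (M.cleanUp_avail_subset B s)
      fun a _ ha => ρ.prob_eq_zero t s a ha).symm
  prob_eq_zero t s a ha := ρ.prob_eq_zero t s a fun h => ha (M.cleanUp_avail_subset B s h)

lemma cost_ofCleanUp (ρ : (M.cleanUp B).Policy) (c : S → A → ℝ≥0) {β : ℝ} (hβ₀ : 0 < β)
    (hβ₁ : β < 1) : ρ.ofCleanUp.cost c β = ρ.cost c β := by
  refine cost_congr (M := M) (N := M.cleanUp B) rfl ρ.ofCleanUp ρ (fun t gM gN h => ?_)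
    (fun s a _ ha f => (nextExp_cleanUp ha f).symm) c hβ₀ hβ₁
  congr 1
  ext s
  refine ρ.avg_congr_of_mem t s fun a ha => h s a (M.cleanUp_avail_subset B s ha) ha

lemma step_ofCleanUp_maxReach (hM : ∀ s, (M.avail s).Nonempty)
    (hB : ∀ s ∈ B, M.IsAbsorbing s) (ρ : (M.cleanUp B).Policy) (t : ℕ) :
    ρ.ofCleanUp.step t (M.maxReach B) = M.maxReach B := by
  ext s
  conv_rhs => rw [← ρ.avg_const t (M.maxReach B)]
  refine ρ.avg_congr_of_mem t (g := fun s a => M.nextExp s a (M.maxReach B)) s fun a ha => ?_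
  exact (mem_cleanUp_avail_iff hM hB (M.cleanUp_avail_subset B s ha)).mp ha

lemma iter_ofCleanUp_maxReach (hM : ∀ s, (M.avail s).Nonempty)
    (hB : ∀ s ∈ B, M.IsAbsorbing s) (ρ : (M.cleanUp B).Policy) (t : ℕ) :
    ρ.ofCleanUp.iter t (M.maxReach B) = M.maxReach B := by
  induction t with
  | zero => rfl
  | succ t ih => rw [iter, step_ofCleanUp_maxReach hM hB, ih]

/-- A policy that attains the maximum reachability probability almost surely visits, at each time,
only states where its decision rule preserves that maximum. -/
lemma iter_maxReach_sub_step (hM : ∀ s, (M.avail s).Nonempty)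
    (hB : ∀ s ∈ B, M.IsAbsorbing s) (π : M.Policy)
    (hπ : π.reachProb B M.init = M.maxReach B M.init) (t : ℕ) :
    π.iter t (M.maxReach B - π.step t (M.maxReach B)) M.init = 0 := by
  obtain ⟨⟨σ, hσ⟩, hle, -⟩ := exists_reachProb_eq_maxReach hM hB
  have hind : ind B ≤ M.maxReach B := hσ ▸ σ.iter_ind_le_reachProb hB 0
  have hstep := π.step_le_of_nextExp_le hle
  have hanti : Antitone fun n => π.iter n (M.maxReach B) M.init :=
    antitone_nat_of_succ_le fun n => π.iter_mono n (hstep n) M.init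
  -- For `k ≥ n` the mean at time `n` dominates the probability of being in `B` at time `k`, which
  -- tends to the maximum as `π` is optimal.
  have hge : ∀ n, M.maxReach B M.init ≤ π.iter n (M.maxReach B) M.init := by
    intro n
    rw [← hπ]
    refine le_of_tendsto (π.tendsto_iter_ind hB M.init) ?_
    filter_upwards [eventually_ge_atTop n] with k hk
    exact (π.iter_mono k hind M.init).trans (hanti hk)
  have heq : ∀ n, π.iter n (M.maxReach B) M.init = M.maxReach B M.init := fun n =>
    (π.iter_le_of_step_le hstep n M.init).antisymm (hge n)
  rw [iter_sub, Pi.sub_apply, heq, sub_eq_zero]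
  exact (heq (t + 1)).symm

open Classical in
/-- A policy of the cleaned-up process that follows `π` wherever this is possible. -/
noncomputable def toCleanUp (π : M.Policy) (ρ : (M.cleanUp B).Policy) :
    (M.cleanUp B).Policy where
  prob t s := if ∀ a, π.prob t s a ≠ 0 → a ∈ (M.cleanUp B).avail s then π.prob t s else ρ.prob t s
  sum_prob t s := by
    split_ifs with h
    · rw [← π.sum_prob t s]
      refine Finset.sum_subset (M.cleanUp_avail_subset B s) fun a _ ha => ?_
      by_contra hne
      exact ha (h a hne)
    · exact ρ.sum_prob t s
  prob_eq_zero t s a ha := by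
    split_ifs with h
    · by_contra hne
      exact ha (h a hne)
    · exact ρ.prob_eq_zero t s a ha

lemma cost_toCleanUp (hM : ∀ s, (M.avail s).Nonempty)
    (hB : ∀ s ∈ B, M.IsAbsorbing s) (π : M.Policy) (ρ : (M.cleanUp B).Policy)
    (hπ : π.reachProb B M.init = M.maxReach B M.init)
    (c : S → A → ℝ≥0) {β : ℝ} (hβ₀ : 0 < β) (hβ₁ : β < 1) :
    π.cost c β = (π.toCleanUp ρ).cost c β := by
  obtain ⟨-, hle, -⟩ := exists_reachProb_eq_maxReach hM hB
  refine cost_congr (M := M) (N := M.cleanUp B) rfl π (π.toCleanUp ρ) (fun t gM gN h => ?_)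
    (fun s a _ ha f => (nextExp_cleanUp ha f).symm) c hβ₀ hβ₁
  rw [← sub_eq_zero, ← Pi.sub_apply, ← iter_sub]
  -- The mean loss of `maxReach` at time `t` is zero. The two averages can differ only in states
  -- with positive loss: without loss, every action in use survives the clean-up and `toCleanUp`
  -- keeps the decision rule of `π`.
  refine π.iter_eq_zero_of_support
    (fun s => sub_nonneg.mpr (π.step_le_of_nextExp_le hle t s))
    (iter_maxReach_sub_step hM hB π hπ t) fun s hs => ?_
  rw [sub_pos]
  by_contra hnot
  refine hs (sub_eq_zero.mpr ?_)
  have hgood : ∀ a, π.prob t s a ≠ 0 → a ∈ (M.cleanUp B).avail s := by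
    intro a hne
    have ha : a ∈ M.avail s := by
      by_contra ha
      exact hne (π.prob_eq_zero t s a ha)
    rw [mem_cleanUp_avail_iff hM hB ha]
    refine (hle s a ha).antisymm (not_lt.mp fun hlt => hnot ?_)
    conv_rhs => rw [← π.avg_const t (M.maxReach B)]
    refine Finset.sum_lt_sum (fun b _ => ?_) ⟨a, Finset.mem_univ _, ?_⟩
    · by_cases hb : b ∈ M.avail s
      · exact mul_le_mul_of_nonneg_left (hle s b hb) (NNReal.coe_nonneg _)
      · simp [π.prob_eq_zero t s b hb]
    · exact mul_lt_mul_of_pos_left hlt (by exact_mod_cast pos_iff_ne_zero.mpr hne)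
  simp only [avg, toCleanUp, if_pos hgood]
  refine Finset.sum_congr rfl fun a _ => ?_
  by_cases hne : π.prob t s a = 0
  · simp [hne]
  · rw [h s a (M.cleanUp_avail_subset B s (hgood a hne)) (hgood a hne)]

end Policy

lemma mem_maxReachPolicies_iff (hM : ∀ s, (M.avail s).Nonempty)
    (hB : ∀ s ∈ B, M.IsAbsorbing s) (π : M.Policy) :
    π ∈ M.maxReachPolicies B ↔ π.reachProb B M.init = M.maxReach B M.init := by
  obtain ⟨⟨σ, hσ⟩, -⟩ := exists_reachProb_eq_maxReach hM hB
  refine ⟨fun h => (reachProb_le_maxReach π _).antisymm ?_, fun h π' => ?_⟩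
  · rw [← hσ]
    exact h σ
  · rw [h]
    exact reachProb_le_maxReach π' _

end MDP

/-- The minimum of the discounted cost over all policies of the cleaned-up MDP is attained, and it
is the infimum of the discounted cost over the (nonempty) set of policies of `M` that maximize the
probability of reaching `B`. -/
theorem corollary1 {S A : Type*} [Fintype S] [Fintype A]
    [MeasurableSpace S] [DiscreteMeasurableSpace S]
    [MeasurableSpace A] [DiscreteMeasurableSpace A]
    (M : MDP S A) (hM : ∀ s, (M.avail s).Nonempty)
    (B : Set S) (hB : ∀ s ∈ B, M.IsAbsorbing s)
    (c : S → A → ℝ≥0) (β : ℝ) (hβ₀ : 0 < β) (hβ₁ : β < 1) :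
    (M.maxReachPolicies B).Nonempty ∧
      ∃ v : ℝ,
        IsGLB ((fun π : M.Policy => π.cost c β) '' M.maxReachPolicies B) v ∧
        IsLeast (Set.range fun π : (M.cleanUp B).Policy => π.cost c β) v := by
  obtain ⟨⟨σ, hσ⟩, -⟩ := MDP.exists_reachProb_eq_maxReach hM hB
  obtain ⟨ρ, hρ⟩ := (M.cleanUp B).exists_cost_le (MDP.cleanUp_avail_nonempty hM hB) c hβ₀ hβ₁
  refine ⟨⟨σ, (MDP.mem_maxReachPolicies_iff hM hB σ).mpr (congrFun hσ _)⟩, ρ.cost c β, ⟨?_, ?_⟩,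
    ⟨ρ, rfl⟩, ?_⟩
  · rintro _ ⟨π, hπ, rfl⟩
    exact (hρ _).trans_eq (MDP.Policy.cost_toCleanUp hM hB π ρ
      ((MDP.mem_maxReachPolicies_iff hM hB π).mp hπ) c hβ₀ hβ₁).symm
  · intro b hb
    rw [← ρ.cost_ofCleanUp c hβ₀ hβ₁]
    -- Each switched policy is optimal for reachability: `ρ` preserves the mean of `maxReach` up to
    -- time `T`, and `σ` then attains it from every state.
    refine ge_of_tendsto (ρ.ofCleanUp.tendsto_cost_switch σ c hβ₀ hβ₁)
      (Filter.Eventually.of_forall fun T => hb ⟨_, ?_, rfl⟩)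
    rw [MDP.mem_maxReachPolicies_iff hM hB, MDP.Policy.reachProb_switch hB, hσ,
      MDP.Policy.iter_ofCleanUp_maxReach hM hB]
  · rintro _ ⟨π, rfl⟩
    exact hρ π
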